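/- For Borel probability measures $\mu,\nu$ on $\mathbb{R}$, let $\mu\triangleright\nu$ denote their monotone convolution, i.e. the distribution of $X+Y$ for monotonically independent random variables $X,Y$ with distributions $\mu,\nu$. Concretely, it is the distribution, in the vector state given by the constant function $1\in L^2(\mathbb{R}^2,\mu\otimes\nu)$, of the sum of the operators $(X\psi)(x,y)=x\int\psi(x,y')\,\nu(dy')$ and $(Y\psi)(x,y)=y\,\psi(x,y)$. Equivalently, it is the unique probability measure with $F_{\mu\triangleright\nu}=F_\mu\circ F_\nu$ on the upper half-plane, where $F_\mu(z)=\left(\int_{\mathbb{R}}\frac{\mu(dt)}{z-t}\right)^{-1}$. For $b>0$ let $D_b\mu(A)=\mu(b^{-1}A)$, and let $m(\mu)$ and $\mathrm{var}(\mu)$ be the mean and the variance of $\mu$. A sequence $(\nu_n)_{n\ge1}$ of Borel probability measures on $\mathbb{R}$ is called stable, with asymptotic constants $a_n\in\mathbb{R}$, if $\lim_{n\to\infty}\nu_n(\{t:|t-a_n|\ge\varepsilon\})=0$ for every $\varepsilon>0$; it is called stable if such constants exist. Theorem. Let $(\mu_n)_{n\ge1}$ be Borel probability measures on $\mathbb{R}$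 with finite variances. (1) If $0<b_1<b_2<\cdots\to\infty$ and $\sum_{k=1}^\infty \mathrm{var}(\mu_k)/b_k^2<\infty$, then the sequence of measures $D_{1/b_n}(\mu_1\triangleright\mu_2\triangleright\cdots\triangleright\mu_n)$, $n\ge1$, is stable, and it is stable with the asymptotic constants $$a_n=\frac1{b_n}\sum_{k=1}^n m(\mu_k).$$ (2) In particular, if $\mu_n=\mu$ for all $n$, then $D_{1/n}(\underbrace{\mu\triangleright\cdots\triangleright\mu}_{n\text{ times}})$ converges weakly to the point mass at $m(\mu)$ as $n\to\infty$. -/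

import Mathlib

open MeasureTheory ProbabilityTheory Filter Topology

noncomputable section

/-- The Cauchy transform `G_μ(z) = ∫ (z - t)⁻¹ μ(dt)`. -/
def cauchyTransform (μ : ProbabilityMeasure ℝ) (z : ℂ) : ℂ :=
  ∫ t, (z - (t : ℂ))⁻¹ ∂(μ : Measure ℝ)

/-- The reciprocal Cauchy transform `F_μ = 1 / G_μ`. -/
def reciprocalCauchyTransform (μ : ProbabilityMeasure ℝ) (z : ℂ) : ℂ :=
  (cauchyTransform μ z)⁻¹

/-- `ρ` is the distribution of the (possibly unbounded) symmetric operator `A` in the vector state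
given by `ω`: for every `z` in the upper half-plane the resolvent equation `(z - A) ψ = ω` has a
solution `ψ` in the domain of `A`, and `⟪ω, (z - A)⁻¹ ω⟫ = ∫ (z - t)⁻¹ ρ(dt)`.  Since
`‖(z - A) ψ‖ ≥ (Im z) ‖ψ‖` for symmetric `A`, the solution is unique, and since a probability
measure is determined by its Cauchy transform, so is `ρ`.  For self-adjoint `A` this `ρ` is the
spectral distribution `B ↦ ⟪ω, 1_B(A) ω⟫`. -/
def HasDistribution {H : Type*} [NormedAddCommGroup H] [InnerProductSpace ℂ H]
    (A : H →ₗ.[ℂ] H) (ω : H) (ρ : ProbabilityMeasure ℝ) : Prop :=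
  ∀ z : ℂ, 0 < z.im → ∃ ψ : A.domain,
    z • (ψ : H) - A ψ = ω ∧ inner ℂ ω (ψ : H) = cauchyTransform ρ z

/-- The Hilbert space `L²(μ) ⊗ L²(ν) = L²(ℝ², μ ⊗ ν)`. -/
abbrev MonotoneSpace (μ ν : ProbabilityMeasure ℝ) : Type :=
  Lp ℂ 2 ((μ : Measure ℝ).prod (ν : Measure ℝ))

/-- The vacuum vector `1 ⊗ 1`. -/
def vacuum (μ ν : ProbabilityMeasure ℝ) : MonotoneSpace μ ν :=
  Lp.const 2 ((μ : Measure ℝ).prod (ν : Measure ℝ)) (1 : ℂ)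

/-- The function `(x, y) ↦ x · ∫ ψ(x, y') ν(dy')`. -/
def leftFun (ν : ProbabilityMeasure ℝ) (ψ : ℝ × ℝ → ℂ) (p : ℝ × ℝ) : ℂ :=
  (p.1 : ℂ) * ∫ y, ψ (p.1, y) ∂(ν : Measure ℝ)

theorem leftFun_add (μ ν : ProbabilityMeasure ℝ) (ψ φ : MonotoneSpace μ ν) :
    leftFun ν (ψ + φ : MonotoneSpace μ ν)
      =ᵐ[(μ : Measure ℝ).prod (ν : Measure ℝ)] leftFun ν ψ + leftFun ν φ := by
  have h1 := Measure.ae_ae_of_ae_prod (Lp.coeFn_add ψ φ)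
  have h2 := ((Lp.memLp ψ).integrable (by norm_num)).prod_right_ae
  have h3 := ((Lp.memLp φ).integrable (by norm_num)).prod_right_ae
  refine Measure.quasiMeasurePreserving_fst.ae (p := fun x : ℝ =>
    (x : ℂ) * ∫ y, (ψ + φ : MonotoneSpace μ ν) (x, y) ∂(ν : Measure ℝ)
      = (x : ℂ) * ∫ y, ψ (x, y) ∂(ν : Measure ℝ) + (x : ℂ) * ∫ y, φ (x, y) ∂(ν : Measure ℝ)) ?_
  filter_upwards [h1, h2, h3] with x h1 h2 h3
  rw [integral_congr_ae h1, ← mul_add, ← integral_add h2 h3]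
  rfl

theorem leftFun_smul (μ ν : ProbabilityMeasure ℝ) (c : ℂ) (ψ : MonotoneSpace μ ν) :
    leftFun ν (c • ψ : MonotoneSpace μ ν)
      =ᵐ[(μ : Measure ℝ).prod (ν : Measure ℝ)] c • leftFun ν ψ := by
  have h1 := Measure.ae_ae_of_ae_prod (Lp.coeFn_smul c ψ)
  refine Measure.quasiMeasurePreserving_fst.ae (p := fun x : ℝ =>
    (x : ℂ) * ∫ y, (c • ψ : MonotoneSpace μ ν) (x, y) ∂(ν : Measure ℝ)
      = c * ((x : ℂ) * ∫ y, ψ (x, y) ∂(ν : Measure ℝ))) ?_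
  filter_upwards [h1] with x h1
  rw [integral_congr_ae h1, mul_left_comm]
  congr 1
  exact integral_const_mul c _

theorem rightFun_add (μ ν : ProbabilityMeasure ℝ) (ψ φ : MonotoneSpace μ ν) :
    (fun p : ℝ × ℝ => (p.2 : ℂ) * (ψ + φ : MonotoneSpace μ ν) p)
      =ᵐ[(μ : Measure ℝ).prod (ν : Measure ℝ)]
        (fun p => (p.2 : ℂ) * ψ p) + fun p => (p.2 : ℂ) * φ p := by
  filter_upwards [Lp.coeFn_add ψ φ] with p h
  rw [h]
  exact mul_add _ _ _

theorem rightFun_smul (μ ν : ProbabilityMeasure ℝ) (c : ℂ) (ψ : MonotoneSpace μ ν) :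
    (fun p : ℝ × ℝ => (p.2 : ℂ) * (c • ψ : MonotoneSpace μ ν) p)
      =ᵐ[(μ : Measure ℝ).prod (ν : Measure ℝ)] c • fun p => (p.2 : ℂ) * ψ p := by
  filter_upwards [Lp.coeFn_smul c ψ] with p h
  rw [h]
  exact mul_left_comm _ _ _

/-- The operator `X = M ⊗ P` on `L²(μ) ⊗ L²(ν)`, where `M` is multiplication by the coordinate
and `P` is the projection onto the constants, on its maximal domain:
`(X ψ)(x, y) = x ∫ ψ(x, y') ν(dy')`.  It has distribution `μ` in the vacuum state. -/
def monotoneLeft (μ ν : ProbabilityMeasure ℝ) : MonotoneSpace μ ν →ₗ.[ℂ] MonotoneSpace μ ν where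
  domain :=
    { carrier := {ψ | MemLp (leftFun ν ψ) 2 ((μ : Measure ℝ).prod (ν : Measure ℝ))}
      add_mem' := fun {ψ φ} hψ hφ =>
        (memLp_congr_ae (leftFun_add μ ν ψ φ)).2 (MemLp.add hψ hφ)
      zero_mem' := by
        have h := leftFun_smul μ ν 0 0
        rw [zero_smul, zero_smul] at h
        exact (memLp_congr_ae h).2 MemLp.zero
      smul_mem' := fun c ψ hψ =>
        (memLp_congr_ae (leftFun_smul μ ν c ψ)).2 (MemLp.const_smul hψ c) }
  toFun :=
    { toFun := fun ψ => MemLp.toLp (leftFun ν ψ.1) ψ.2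
      map_add' := fun ψ φ => by
        rw [← MemLp.toLp_add]
        exact MemLp.toLp_congr _ _ (leftFun_add μ ν ψ φ)
      map_smul' := fun c ψ => by
        rw [RingHom.id_apply, ← MemLp.toLp_const_smul]
        exact MemLp.toLp_congr _ _ (leftFun_smul μ ν c ψ) }

/-- The operator `Y = 1 ⊗ M` on `L²(μ) ⊗ L²(ν)` on its maximal domain: `(Y ψ)(x, y) = y ψ(x, y)`.
It has distribution `ν` in the vacuum state. -/
def monotoneRight (μ ν : ProbabilityMeasure ℝ) : MonotoneSpace μ ν →ₗ.[ℂ] MonotoneSpace μ ν where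
  domain :=
    { carrier := {ψ | MemLp (fun p : ℝ × ℝ => (p.2 : ℂ) * ψ p) 2
        ((μ : Measure ℝ).prod (ν : Measure ℝ))}
      add_mem' := fun {ψ φ} hψ hφ =>
        (memLp_congr_ae (rightFun_add μ ν ψ φ)).2 (MemLp.add hψ hφ)
      zero_mem' := by
        have h := rightFun_smul μ ν 0 0
        rw [zero_smul, zero_smul] at h
        exact (memLp_congr_ae h).2 MemLp.zero
      smul_mem' := fun c ψ hψ =>
        (memLp_congr_ae (rightFun_smul μ ν c ψ)).2 (MemLp.const_smul hψ c) }
  toFun :=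
    { toFun := fun ψ => MemLp.toLp (fun p : ℝ × ℝ => (p.2 : ℂ) * ψ.1 p) ψ.2
      map_add' := fun ψ φ => by
        rw [← MemLp.toLp_add]
        exact MemLp.toLp_congr _ _ (rightFun_add μ ν ψ φ)
      map_smul' := fun c ψ => by
        rw [RingHom.id_apply, ← MemLp.toLp_const_smul]
        exact MemLp.toLp_congr _ _ (rightFun_smul μ ν c ψ) }

/-- `ρ` is the distribution of `X + Y` in the vacuum state, where `X = M ⊗ P` and `Y = 1 ⊗ M` are the
universal realization of monotonically independent random variables with distributions `μ` and
`ν`: since `f(X) = f(M) ⊗ P` when `f 0 = 0`, one has `f(X) g(Y) h(X) = (∫ g dν) f(X) h(X)` when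
`f 0 = h 0 = 0`, and `⟪1, g(Y) f(X) h(Y) 1⟫ = (∫ g dν) (∫ f dμ) (∫ h dν)`. -/
def IsMonotoneConvolution (μ ν ρ : ProbabilityMeasure ℝ) : Prop :=
  HasDistribution (monotoneLeft μ ν + monotoneRight μ ν) (vacuum μ ν) ρ

theorem norm_inv_sub_ofReal_le {z : ℂ} (hz : 0 < z.im) (t : ℝ) :
    ‖(z - (t : ℂ))⁻¹‖ ≤ z.im⁻¹ := by
  rw [norm_inv]
  have h := Complex.abs_im_le_norm (z - (t : ℂ))
  rw [Complex.sub_im, Complex.ofReal_im, sub_zero, abs_of_pos hz] at h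
  exact inv_anti₀ hz h

theorem sub_ofReal_ne_zero {z : ℂ} (hz : 0 < z.im) (t : ℝ) : z - (t : ℂ) ≠ 0 := by
  intro h
  have := congrArg Complex.im h
  simp at this
  exact hz.ne' this

theorem integrable_inv_sub_ofReal (μ : ProbabilityMeasure ℝ) {z : ℂ} (hz : 0 < z.im) :
    Integrable (fun t : ℝ => (z - (t : ℂ))⁻¹) (μ : Measure ℝ) :=
  Integrable.of_bound (by fun_prop) z.im⁻¹ (ae_of_all _ fun t => norm_inv_sub_ofReal_le hz t)

theorem cauchyTransform_im_neg (μ : ProbabilityMeasure ℝ) {z : ℂ} (hz : 0 < z.im) :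
    (cauchyTransform μ z).im < 0 := by
  have hi := integrable_inv_sub_ofReal μ hz
  have h : (cauchyTransform μ z).im = ∫ t, ((z - (t : ℂ))⁻¹).im ∂(μ : Measure ℝ) :=
    (integral_im hi).symm
  have hneg : ∀ t : ℝ, 0 < -((z - (t : ℂ))⁻¹).im := fun t => by
    rw [Complex.inv_im, Complex.sub_im, Complex.ofReal_im, sub_zero, neg_div, neg_neg]
    exact div_pos hz (Complex.normSq_pos.2 (sub_ofReal_ne_zero hz t))
  have hpos : 0 < ∫ t, -((z - (t : ℂ))⁻¹).im ∂(μ : Measure ℝ) := by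
    rw [integral_pos_iff_support_of_nonneg (fun t => (hneg t).le) hi.im.neg]
    rw [show Function.support (fun t : ℝ => -((z - (t : ℂ))⁻¹).im) = Set.univ from
      Set.eq_univ_of_forall fun t => (hneg t).ne']
    simp
  rw [integral_neg] at hpos
  linarith

theorem reciprocalCauchyTransform_im_pos (μ : ProbabilityMeasure ℝ) {z : ℂ} (hz : 0 < z.im) :
    0 < (reciprocalCauchyTransform μ z).im := by
  have h := cauchyTransform_im_neg μ hz
  have h0 : cauchyTransform μ z ≠ 0 := fun h0 => by simp [h0] at h
  rw [reciprocalCauchyTransform, Complex.inv_im]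
  exact div_pos (by linarith) (Complex.normSq_pos.2 h0)

theorem vacuum_ae (μ ν : ProbabilityMeasure ℝ) :
    vacuum μ ν =ᵐ[(μ : Measure ℝ).prod (ν : Measure ℝ)] fun _ => (1 : ℂ) :=
  Lp.coeFn_const 2 _ (1 : ℂ)

theorem inner_vacuum (μ ν : ProbabilityMeasure ℝ) (ψ : MonotoneSpace μ ν) :
    inner ℂ (vacuum μ ν) ψ
      = ∫ x, ∫ y, ψ (x, y) ∂(ν : Measure ℝ) ∂(μ : Measure ℝ) := by
  rw [L2.inner_def, ← integral_prod _ ((Lp.memLp ψ).integrable (by norm_num))]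
  refine integral_congr_ae ?_
  filter_upwards [vacuum_ae μ ν] with p h
  simp [h]

/-- Solving the resolvent equation of `X + Y` in a fibre. -/
theorem inner_vacuum_of_resolvent (μ ν : ProbabilityMeasure ℝ) {z : ℂ} (hz : 0 < z.im)
    (ψ : (monotoneLeft μ ν + monotoneRight μ ν).domain)
    (h : z • (ψ : MonotoneSpace μ ν) - (monotoneLeft μ ν + monotoneRight μ ν) ψ = vacuum μ ν) :
    inner ℂ (vacuum μ ν) (ψ : MonotoneSpace μ ν)
      = cauchyTransform μ (reciprocalCauchyTransform ν z) := by
  rw [inner_vacuum, cauchyTransform]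
  refine integral_congr_ae ?_
  have hF := reciprocalCauchyTransform_im_pos ν hz
  have hG : cauchyTransform ν z ≠ 0 := fun h0 => by
    have := cauchyTransform_im_neg ν hz
    simp [h0] at this
  have hmain : ∀ᵐ p ∂(μ : Measure ℝ).prod (ν : Measure ℝ),
      z * (ψ : MonotoneSpace μ ν) p - (leftFun ν (ψ : MonotoneSpace μ ν) p
        + (p.2 : ℂ) * (ψ : MonotoneSpace μ ν) p) = 1 := by
    have hX := MemLp.coeFn_toLp ψ.2.1
    have hY := MemLp.coeFn_toLp ψ.2.2
    have hXY := Lp.coeFn_add (MemLp.toLp _ ψ.2.1) (MemLp.toLp _ ψ.2.2)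
    have hs := Lp.coeFn_sub (z • (ψ : MonotoneSpace μ ν))
      ((monotoneLeft μ ν + monotoneRight μ ν) ψ)
    rw [h] at hs
    filter_upwards [hX, hY, hXY, hs, Lp.coeFn_smul z (ψ : MonotoneSpace μ ν), vacuum_ae μ ν]
      with p hX hY hXY hs hz1 hv
    rw [hv, Pi.sub_apply, hz1, Pi.smul_apply, smul_eq_mul] at hs
    rw [Pi.add_apply, hX, hY] at hXY
    rw [← hXY]
    exact hs.symm
  filter_upwards [Measure.ae_ae_of_ae_prod hmain] with x hx
  set c : ℂ := ∫ y, (ψ : MonotoneSpace μ ν) (x, y) ∂(ν : Measure ℝ) with hc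
  have hx' : ∀ᵐ y ∂(ν : Measure ℝ), (ψ : MonotoneSpace μ ν) (x, y)
      = (1 + (x : ℂ) * c) * (z - (y : ℂ))⁻¹ := by
    filter_upwards [hx] with y hy
    rw [eq_mul_inv_iff_mul_eq₀ (sub_ofReal_ne_zero hz y)]
    have hl : leftFun ν (ψ : MonotoneSpace μ ν) (x, y) = (x : ℂ) * c := rfl
    rw [hl] at hy
    linear_combination hy
  have hcc : c = (1 + (x : ℂ) * c) * cauchyTransform ν z := by
    rw [cauchyTransform, ← integral_const_mul, ← integral_congr_ae hx']
  have hne := sub_ofReal_ne_zero hF x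
  rw [eq_comm, inv_eq_iff_eq_inv, eq_comm, inv_eq_iff_eq_inv, eq_comm, ← one_div,
    div_eq_iff hne, reciprocalCauchyTransform, mul_sub]
  field_simp
  linear_combination -hcc

/-- The resolvent equation of `X + Y` is solvable for the vacuum vector. -/
theorem exists_resolvent (μ ν : ProbabilityMeasure ℝ) {z : ℂ} (hz : 0 < z.im) :
    ∃ ψ : (monotoneLeft μ ν + monotoneRight μ ν).domain,
      z • (ψ : MonotoneSpace μ ν) - (monotoneLeft μ ν + monotoneRight μ ν) ψ = vacuum μ ν := by
  set F : ℂ := reciprocalCauchyTransform ν z with hFdef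
  have hF : 0 < F.im := reciprocalCauchyTransform_im_pos ν hz
  have hG : cauchyTransform ν z ≠ 0 := fun h0 => by
    have := cauchyTransform_im_neg ν hz
    simp [h0] at this
  have hGF : cauchyTransform ν z * F = 1 := mul_inv_cancel₀ hG
  let f : ℝ × ℝ → ℂ := fun p => F * (F - (p.1 : ℂ))⁻¹ * (z - (p.2 : ℂ))⁻¹
  have hbd : ∀ {w : ℂ}, 0 < w.im → ∀ t : ℝ, ‖(t : ℂ) * (w - (t : ℂ))⁻¹‖ ≤ ‖w‖ * w.im⁻¹ + 1 := by
    intro w hw t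
    have : (t : ℂ) * (w - (t : ℂ))⁻¹ = w * (w - (t : ℂ))⁻¹ - 1 := by
      field_simp [sub_ofReal_ne_zero hw t]
      ring
    rw [this]
    refine (norm_sub_le _ _).trans ?_
    rw [norm_mul, norm_one]
    gcongr
    exact norm_inv_sub_ofReal_le hw t
  have hfm : MemLp f 2 ((μ : Measure ℝ).prod (ν : Measure ℝ)) := by
    refine MemLp.of_bound (by fun_prop) (‖F‖ * F.im⁻¹ * z.im⁻¹) (ae_of_all _ fun p => ?_)
    rw [norm_mul, norm_mul]
    gcongr
    · exact norm_inv_sub_ofReal_le hF p.1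
    · exact norm_inv_sub_ofReal_le hz p.2
  have hleft : leftFun ν (hfm.toLp f) =ᵐ[(μ : Measure ℝ).prod (ν : Measure ℝ)]
      fun p => (p.1 : ℂ) * (F - (p.1 : ℂ))⁻¹ := by
    refine Measure.quasiMeasurePreserving_fst.ae (p := fun x : ℝ =>
      (x : ℂ) * ∫ y, (hfm.toLp f) (x, y) ∂(ν : Measure ℝ) = (x : ℂ) * (F - (x : ℂ))⁻¹) ?_
    filter_upwards [Measure.ae_ae_of_ae_prod (MemLp.coeFn_toLp hfm)] with x hx
    rw [integral_congr_ae hx]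
    have : ∫ y, f (x, y) ∂(ν : Measure ℝ) = F * (F - (x : ℂ))⁻¹ * cauchyTransform ν z := by
      rw [cauchyTransform, ← integral_const_mul]
    rw [this]
    linear_combination (x : ℂ) * (F - (x : ℂ))⁻¹ * hGF
  have hright : (fun p : ℝ × ℝ => (p.2 : ℂ) * (hfm.toLp f) p)
      =ᵐ[(μ : Measure ℝ).prod (ν : Measure ℝ)]
        fun p => F * (F - (p.1 : ℂ))⁻¹ * ((p.2 : ℂ) * (z - (p.2 : ℂ))⁻¹) := by
    filter_upwards [MemLp.coeFn_toLp hfm] with p hp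
    rw [hp]
    simp only [f]
    ring
  have hX : MemLp (leftFun ν (hfm.toLp f)) 2 ((μ : Measure ℝ).prod (ν : Measure ℝ)) := by
    refine (memLp_congr_ae hleft).2 ?_
    exact MemLp.of_bound (by fun_prop) _ (ae_of_all _ fun p => hbd hF p.1)
  have hY : MemLp (fun p : ℝ × ℝ => (p.2 : ℂ) * (hfm.toLp f) p) 2
      ((μ : Measure ℝ).prod (ν : Measure ℝ)) := by
    refine (memLp_congr_ae hright).2 ?_
    refine MemLp.of_bound (by fun_prop) (‖F‖ * F.im⁻¹ * (‖z‖ * z.im⁻¹ + 1))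
      (ae_of_all _ fun p => ?_)
    rw [norm_mul, norm_mul]
    gcongr
    · exact norm_inv_sub_ofReal_le hF p.1
    · exact hbd hz p.2
  refine ⟨⟨hfm.toLp f, hX, hY⟩, ?_⟩
  have hsum : (monotoneLeft μ ν + monotoneRight μ ν) ⟨hfm.toLp f, hX, hY⟩
      = hX.toLp _ + hY.toLp _ := rfl
  rw [hsum]
  refine Lp.ext ?_
  filter_upwards [Lp.coeFn_sub (z • hfm.toLp f) (hX.toLp _ + hY.toLp _),
    Lp.coeFn_smul z (hfm.toLp f), Lp.coeFn_add (hX.toLp _) (hY.toLp _), hX.coeFn_toLp,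
    hY.coeFn_toLp, vacuum_ae μ ν, hleft, hright, hfm.coeFn_toLp]
    with p h1 h2 h3 h4 h5 h6 h7 h8 h9
  rw [h1, h6, Pi.sub_apply, h2, h3, Pi.smul_apply, Pi.add_apply, h4, h5, h7, h8, h9]
  have n1 := sub_ofReal_ne_zero hF p.1
  have n2 := sub_ofReal_ne_zero hz p.2
  simp only [f, smul_eq_mul]
  field_simp
  ring

/-- The operator definition amounts to composition of reciprocal Cauchy transforms. -/
theorem isMonotoneConvolution_iff (μ ν ρ : ProbabilityMeasure ℝ) :
    IsMonotoneConvolution μ ν ρ ↔ ∀ z : ℂ, 0 < z.im →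
      reciprocalCauchyTransform ρ z
        = reciprocalCauchyTransform μ (reciprocalCauchyTransform ν z) := by
  constructor
  · intro h z hz
    obtain ⟨ψ, h1, h2⟩ := h z hz
    rw [inner_vacuum_of_resolvent μ ν hz ψ h1] at h2
    rw [reciprocalCauchyTransform, ← h2]
    rfl
  · intro h z hz
    obtain ⟨ψ, hψ⟩ := exists_resolvent μ ν hz
    refine ⟨ψ, hψ, ?_⟩
    rw [inner_vacuum_of_resolvent μ ν hz ψ hψ]
    exact (inv_injective (h z hz)).symm

/-- The monotone convolution `μ ▷ ν`: the distribution of `X + Y`. -/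
def monotoneConvolution (μ ν : ProbabilityMeasure ℝ) : ProbabilityMeasure ℝ :=
  Classical.epsilon (IsMonotoneConvolution μ ν)

/-- For `μ 0, μ 1, …` standing for `μ₁, μ₂, …`, the value at `n` is `μ₁ ▷ μ₂ ▷ ⋯ ▷ μ_{n+1}`. -/
def iteratedMonotoneConvolution (μ : ℕ → ProbabilityMeasure ℝ) : ℕ → ProbabilityMeasure ℝ
  | 0 => μ 0
  | n + 1 => monotoneConvolution (iteratedMonotoneConvolution μ n) (μ (n + 1))

/-- The dilation `D_b μ (A) = μ (b⁻¹ A)`, the law of `b t` when `t` has law `μ`. -/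
def dilation (b : ℝ) (μ : ProbabilityMeasure ℝ) : ProbabilityMeasure ℝ :=
  μ.map (f := fun t => b * t) (measurable_const_mul b).aemeasurable

/-- The sequence `ν` is stable with asymptotic constants `a`. -/
def IsStableWith (ν : ℕ → ProbabilityMeasure ℝ) (a : ℕ → ℝ) : Prop :=
  ∀ ε : ℝ, 0 < ε →
    Tendsto (fun n => (ν n : Measure ℝ) {t : ℝ | ε ≤ |t - a n|}) atTop (𝓝 0)

/-- The sequence `ν` is stable. -/
def IsStableSequence (ν : ℕ → ProbabilityMeasure ℝ) : Prop :=
  ∃ a : ℕ → ℝ, IsStableWith ν a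

end

/-
When `μ` and `ν` have finite variance, the vacuum vector `ω` lies in the domain of the formally
self-adjoint operator `A = X + Y`. Take `z = c + iy` with `c` real and let `y → ∞`: applied to
`φ = (z - c) (z - A)⁻¹ ω - ω = (z - A)⁻¹ (A - c) ω`, the bound `y ‖φ‖ ≤ ‖(z - A) φ‖` shows that a
distribution `ρ` of `A` in the state `ω` satisfies
`∫ (t - c)² dρ ≤ ‖(A - c) ω‖² = ∫∫ (x + y - c)² dμ dν`. As this holds for every `c`, the means add
up under `▷` and the variance is subadditive, so that (1) follows from Kronecker's lemma and
Chebyshev's inequality as in the classical law of large numbers, and (2) is the case `b_n = n`.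

A distribution of `X + Y` exists by the spectral theorem when `μ` and `ν` have finite support. In
general one approximates: the Cauchy transforms converge to `G_μ ∘ F_ν`, and
`r Im G_μ(F_ν(ir)) → -1` as `r → ∞` makes the approximating distributions tight.
-/

section CauchyTransform

theorem cauchyTransform_ne_zero (μ : ProbabilityMeasure ℝ) {z : ℂ} (hz : 0 < z.im) :
    cauchyTransform μ z ≠ 0 := fun h =>
  (cauchyTransform_im_neg μ hz).ne (by rw [h, Complex.zero_im])

theorem im_inv_mk_sub_ofReal (c y t : ℝ) :
    (((⟨c, y⟩ : ℂ) - (t : ℂ))⁻¹).im = -y / ((t - c) ^ 2 + y ^ 2) := by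
  simp only [Complex.inv_im, Complex.normSq_apply, Complex.sub_re, Complex.sub_im,
    Complex.ofReal_re, Complex.ofReal_im, sub_zero]
  congr 1
  ring

theorem one_add_mul_im_cauchyTransform (ρ : ProbabilityMeasure ℝ) (c : ℝ) {y : ℝ} (hy : 0 < y) :
    1 + y * (cauchyTransform ρ ⟨c, y⟩).im
      = ∫ t, (t - c) ^ 2 / ((t - c) ^ 2 + y ^ 2) ∂(ρ : Measure ℝ) := by
  have hi := integrable_inv_sub_ofReal ρ (z := ⟨c, y⟩) hy
  have him : (cauchyTransform ρ ⟨c, y⟩).im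
      = ∫ t, (((⟨c, y⟩ : ℂ) - (t : ℂ))⁻¹).im ∂(ρ : Measure ℝ) := (integral_im hi).symm
  have hi' : Integrable (fun t : ℝ => y * (((⟨c, y⟩ : ℂ) - (t : ℂ))⁻¹).im) (ρ : Measure ℝ) :=
    hi.im.const_mul y
  calc 1 + y * (cauchyTransform ρ ⟨c, y⟩).im
      = ∫ t, 1 + y * (((⟨c, y⟩ : ℂ) - (t : ℂ))⁻¹).im ∂(ρ : Measure ℝ) := by
        rw [integral_add (integrable_const _) hi', integral_const_mul, him, integral_const,
          probReal_univ, one_smul]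
    _ = ∫ t, (t - c) ^ 2 / ((t - c) ^ 2 + y ^ 2) ∂(ρ : Measure ℝ) := by
        refine integral_congr_ae (ae_of_all _ fun t => ?_)
        simp only [im_inv_mk_sub_ofReal]
        field_simp
        ring

theorem integrable_sq_div_sq_add_sq (m : Measure ℝ) [IsFiniteMeasure m] (c y : ℝ) :
    Integrable (fun t : ℝ => (t - c) ^ 2 / ((t - c) ^ 2 + y ^ 2)) m := by
  refine Integrable.of_bound (by fun_prop : Measurable _).aestronglyMeasurable 1
    (ae_of_all _ fun t => ?_)
  rw [Real.norm_of_nonneg (by positivity)]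
  exact div_le_one_of_le₀ (by nlinarith) (by positivity)

theorem tendsto_sq_mul_div_add_sq (u : ℝ) :
    Tendsto (fun y : ℝ => y ^ 2 * (u / (u + y ^ 2))) atTop (𝓝 u) := by
  have hinv : Tendsto (fun y : ℝ => u / y ^ 2) atTop (𝓝 0) :=
    tendsto_const_nhds.div_atTop (tendsto_pow_atTop two_ne_zero)
  have hdiv := (tendsto_const_nhds (x := u)).div (hinv.add_const 1) (by norm_num)
  rw [zero_add, div_one] at hdiv
  refine hdiv.congr' ?_
  filter_upwards [eventually_gt_atTop 0] with y hy
  simp only [Pi.div_apply]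
  field_simp

theorem lintegral_sub_sq_le_of_cauchyTransform {ρ : ProbabilityMeasure ℝ} {c V : ℝ}
    (h : ∀ y : ℝ, 0 < y → y ^ 2 * (1 + y * (cauchyTransform ρ ⟨c, y⟩).im) ≤ V) :
    ∫⁻ t, ENNReal.ofReal ((t - c) ^ 2) ∂(ρ : Measure ℝ) ≤ ENNReal.ofReal V := by
  let k : ℕ → ℝ → ℝ := fun n t =>
    (n + 1 : ℝ) ^ 2 * ((t - c) ^ 2 / ((t - c) ^ 2 + (n + 1 : ℝ) ^ 2))
  have hlim : ∀ t, Tendsto (fun n => k n t) atTop (𝓝 ((t - c) ^ 2)) := fun t =>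
    (tendsto_sq_mul_div_add_sq _).comp
      (tendsto_atTop_add_const_right _ 1 tendsto_natCast_atTop_atTop)
  have hk : ∀ n, ∫⁻ t, ENNReal.ofReal (k n t) ∂(ρ : Measure ℝ) ≤ ENNReal.ofReal V := fun n => by
    rw [← ofReal_integral_eq_lintegral_ofReal ((integrable_sq_div_sq_add_sq ρ c _).const_mul _)
      (ae_of_all _ fun t => by positivity), integral_const_mul,
      ← one_add_mul_im_cauchyTransform ρ c (by positivity)]
    exact ENNReal.ofReal_le_ofReal (h _ (by positivity))
  calc ∫⁻ t, ENNReal.ofReal ((t - c) ^ 2) ∂(ρ : Measure ℝ)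
      = ∫⁻ t, liminf (fun n => ENNReal.ofReal (k n t)) atTop ∂(ρ : Measure ℝ) :=
        lintegral_congr fun t => (ENNReal.tendsto_ofReal (hlim t)).liminf_eq.symm
    _ ≤ liminf (fun n => ∫⁻ t, ENNReal.ofReal (k n t) ∂(ρ : Measure ℝ)) atTop :=
        lintegral_liminf_le fun n => (by fun_prop : Measurable (k n)).ennreal_ofReal
    _ ≤ ENNReal.ofReal V :=
        liminf_le_of_frequently_le' (Eventually.of_forall hk).frequently

theorem measure_lt_norm_le_of_cauchyTransform (ρ : ProbabilityMeasure ℝ) {r : ℝ} (hr : 0 < r) :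
    (ρ : Measure ℝ) {t | r < ‖t‖}
      ≤ ENNReal.ofReal (2 * (1 + r * (cauchyTransform ρ ⟨0, r⟩).im)) := by
  have hi := integrable_sq_div_sq_add_sq ρ 0 r
  have hmarkov := mul_meas_ge_le_integral_of_nonneg (μ := (ρ : Measure ℝ))
    (ae_of_all _ fun t => by positivity) hi (1 / 2)
  rw [← one_add_mul_im_cauchyTransform ρ 0 hr] at hmarkov
  have hsub : {t : ℝ | r < ‖t‖} ⊆ {t | 1 / 2 ≤ (t - 0) ^ 2 / ((t - 0) ^ 2 + r ^ 2)} := by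
    intro t ht
    have hrt : r ^ 2 < t ^ 2 := sq_lt_sq.2 (by rwa [abs_of_pos hr])
    rw [Set.mem_ofPred_eq, sub_zero, div_le_div_iff₀ two_pos (by positivity)]
    linarith
  rw [← ofReal_measureReal (measure_ne_top _ _)]
  refine ENNReal.ofReal_le_ofReal ((measureReal_mono hsub (measure_ne_top _ _)).trans ?_)
  linarith

theorem tendsto_cauchyTransform {ι : Type*} {l : Filter ι} {μs : ι → ProbabilityMeasure ℝ}
    {μ : ProbabilityMeasure ℝ} (hμ : Tendsto μs l (𝓝 μ)) {z : ℂ} (hz : 0 < z.im) :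
    Tendsto (fun i => cauchyTransform (μs i) z) l (𝓝 (cauchyTransform μ z)) := by
  have hc : Continuous fun t : ℝ => (z - (t : ℂ))⁻¹ :=
    Continuous.inv₀ (by fun_prop) (sub_ofReal_ne_zero hz)
  exact (ProbabilityMeasure.tendsto_iff_forall_integral_rclike_tendsto ℂ).1 hμ
    (BoundedContinuousFunction.ofNormedAddCommGroup _ hc _ (norm_inv_sub_ofReal_le hz))

theorem norm_cauchyTransform_sub_le (μ : ProbabilityMeasure ℝ) {z w : ℂ} (hz : 0 < z.im)
    (hw : 0 < w.im) :
    ‖cauchyTransform μ w - cauchyTransform μ z‖ ≤ w.im⁻¹ * ‖w - z‖ * z.im⁻¹ := by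
  rw [cauchyTransform, cauchyTransform,
    ← integral_sub (integrable_inv_sub_ofReal μ hw) (integrable_inv_sub_ofReal μ hz)]
  refine (norm_integral_le_of_norm_le_const (ae_of_all _ fun t => ?_)).trans_eq
    (by rw [probReal_univ, mul_one])
  rw [inv_sub_inv' (sub_ofReal_ne_zero hw t) (sub_ofReal_ne_zero hz t), sub_sub_sub_cancel_right,
    norm_mul, norm_mul, norm_sub_rev w]
  gcongr
  · exact norm_inv_sub_ofReal_le hw t
  · exact norm_inv_sub_ofReal_le hz t

theorem tendsto_cauchyTransform_of_tendsto {ι : Type*} {l : Filter ι}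
    {μs : ι → ProbabilityMeasure ℝ} {μ : ProbabilityMeasure ℝ} (hμ : Tendsto μs l (𝓝 μ))
    {w : ι → ℂ} {z : ℂ} (hz : 0 < z.im) (hw : Tendsto w l (𝓝 z)) :
    Tendsto (fun i => cauchyTransform (μs i) (w i)) l (𝓝 (cauchyTransform μ z)) := by
  have him : Tendsto (fun i => (w i).im) l (𝓝 z.im) := (Complex.continuous_im.tendsto z).comp hw
  have hbound : Tendsto (fun i => (w i).im⁻¹ * ‖w i - z‖ * z.im⁻¹) l (𝓝 0) := by
    simpa using ((him.inv₀ hz.ne').mul (hw.sub_const z).norm).mul_const z.im⁻¹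
  have hdiff : Tendsto (fun i => cauchyTransform (μs i) (w i) - cauchyTransform (μs i) z) l
      (𝓝 0) := by
    refine squeeze_zero_norm' ?_ hbound
    filter_upwards [him.eventually_const_lt hz] with i hi
    exact norm_cauchyTransform_sub_le (μs i) hz hi
  simpa using hdiff.add (tendsto_cauchyTransform hμ hz)

theorem exists_cauchyTransform_eq_of_tendsto {ρs : ℕ → ProbabilityMeasure ℝ} {g : ℂ → ℂ}
    (hg : ∀ z : ℂ, 0 < z.im → Tendsto (fun n => cauchyTransform (ρs n) z) atTop (𝓝 (g z)))
    (htop : Tendsto (fun r : ℝ => r * (g ⟨0, r⟩).im) atTop (𝓝 (-1))) :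
    ∃ ρ : ProbabilityMeasure ℝ, ∀ z : ℂ, 0 < z.im → cauchyTransform ρ z = g z := by
  have htail : Tendsto (fun r : ℝ => ENNReal.ofReal (2 * (1 + r * (g ⟨0, r⟩).im))) atTop
      (𝓝 0) := by
    simpa using ENNReal.tendsto_ofReal ((htop.const_add 1).const_mul 2)
  have htight : IsTightMeasureSet (Set.range fun n => (ρs n : Measure ℝ)) := by
    refine isTightMeasureSet_range_of_tendsto_limsup_measure_norm_gt ?_
    refine tendsto_of_tendsto_of_tendsto_of_le_of_le' tendsto_const_nhds htail
      (Eventually.of_forall fun _ => zero_le) ?_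
    filter_upwards [eventually_gt_atTop 0] with r hr
    have him : Tendsto (fun n => (cauchyTransform (ρs n) ⟨0, r⟩).im) atTop (𝓝 (g ⟨0, r⟩).im) :=
      (Complex.continuous_im.tendsto _).comp (hg ⟨0, r⟩ hr)
    have hlim := ENNReal.tendsto_ofReal (((him.const_mul r).const_add 1).const_mul 2)
    rw [← hlim.limsup_eq]
    exact limsup_le_limsup (Eventually.of_forall fun n =>
      measure_lt_norm_le_of_cauchyTransform (ρs n) hr)
  have hcompact : IsCompact (closure (Set.range ρs)) := by
    refine isCompact_closure_of_isTightMeasureSet ?_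
    convert htight
    ext m
    simp
  obtain ⟨ρ, -, hρ⟩ := hcompact.ultrafilter_le_nhds ((hyperfilter ℕ).map ρs)
    (le_principal_iff.2 (Ultrafilter.mem_map.2 (univ_mem' fun n => subset_closure ⟨n, rfl⟩)))
  have hρ' : Tendsto ρs (hyperfilter ℕ : Filter ℕ) (𝓝 ρ) := hρ
  exact ⟨ρ, fun z hz => tendsto_nhds_unique (tendsto_cauchyTransform hρ' hz)
    ((hg z hz).mono_left Nat.hyperfilter_le_atTop)⟩

theorem tendsto_mul_cauchyTransform (μ : ProbabilityMeasure ℝ) {w : ℝ → ℂ}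
    (hw : Tendsto (fun y : ℝ => w y / y) atTop (𝓝 Complex.I)) :
    Tendsto (fun y : ℝ => y * cauchyTransform μ (w y)) atTop (𝓝 (-Complex.I)) := by
  have him : ∀ᶠ y : ℝ in atTop, 1 / 2 < (w y).im / y := by
    have hlim := (Complex.continuous_im.tendsto _).comp hw
    filter_upwards [hlim.eventually_const_lt (by norm_num : (1 / 2 : ℝ) < Complex.I.im)] with y hy
    simpa using hy
  have hint : Tendsto (fun y : ℝ => ∫ t, y * (w y - (t : ℂ))⁻¹ ∂(μ : Measure ℝ)) atTop
      (𝓝 (∫ _, -Complex.I ∂(μ : Measure ℝ))) := by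
    refine tendsto_integral_filter_of_dominated_convergence (fun _ => 2)
      (Eventually.of_forall fun y => by fun_prop) ?_ (integrable_const _) (ae_of_all _ fun t => ?_)
    · filter_upwards [him, eventually_gt_atTop 0] with y hwy hy
      rw [lt_div_iff₀ hy] at hwy
      refine ae_of_all _ fun t => ?_
      rw [norm_mul, Complex.norm_of_nonneg hy.le]
      calc y * ‖(w y - (t : ℂ))⁻¹‖ ≤ y * (w y).im⁻¹ := by
            gcongr
            exact norm_inv_sub_ofReal_le (by linarith) t
        _ ≤ 2 := by
            rw [← div_eq_mul_inv, div_le_iff₀ (by linarith)]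
            linarith
    · have ht : Tendsto (fun y : ℝ => (t : ℂ) / y) atTop (𝓝 0) := by
        have hreal := Complex.continuous_ofReal.continuousAt.tendsto.comp
          (tendsto_id.const_div_atTop t)
        simpa [Function.comp_def] using hreal
      have hinv := (hw.sub ht).inv₀ (by simp)
      rw [sub_zero, Complex.inv_I] at hinv
      refine hinv.congr fun y => ?_
      rw [← sub_div, inv_div, div_eq_mul_inv]
  simpa only [cauchyTransform, integral_const_mul, integral_const, probReal_univ, one_smul]
    using hint

theorem tendsto_reciprocalCauchyTransform_div (ν : ProbabilityMeasure ℝ) :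
    Tendsto (fun y : ℝ => reciprocalCauchyTransform ν ⟨0, y⟩ / y) atTop (𝓝 Complex.I) := by
  have hw : Tendsto (fun y : ℝ => (⟨0, y⟩ : ℂ) / y) atTop (𝓝 Complex.I) := by
    refine tendsto_const_nhds.congr' ?_
    filter_upwards [eventually_ne_atTop 0] with y hy
    rw [eq_div_iff (Complex.ofReal_ne_zero.2 hy)]
    simp [Complex.ext_iff]
  have hinv := (tendsto_mul_cauchyTransform ν hw).inv₀ (neg_ne_zero.2 Complex.I_ne_zero)
  rw [inv_neg, Complex.inv_I, neg_neg] at hinv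
  refine hinv.congr fun y => ?_
  rw [reciprocalCauchyTransform, mul_inv, mul_comm, div_eq_mul_inv]

end CauchyTransform

section FormallySelfAdjoint

theorem isFormalAdjoint_add {𝕜 E F : Type*} [RCLike 𝕜] [NormedAddCommGroup E]
    [InnerProductSpace 𝕜 E] [NormedAddCommGroup F] [InnerProductSpace 𝕜 F]
    {A B : E →ₗ.[𝕜] F} {A' B' : F →ₗ.[𝕜] E} (hA : A.IsFormalAdjoint A')
    (hB : B.IsFormalAdjoint B') : (A + B).IsFormalAdjoint (A' + B') := fun ψ φ => by
  rw [LinearPMap.add_apply, LinearPMap.add_apply, inner_add_left, inner_add_right]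
  exact congrArg₂ (· + ·) (hA ⟨ψ, ψ.2.1⟩ ⟨φ, φ.2.1⟩) (hB ⟨ψ, ψ.2.2⟩ ⟨φ, φ.2.2⟩)

variable {H : Type*} [NormedAddCommGroup H] [InnerProductSpace ℂ H] {A : H →ₗ.[ℂ] H}

theorem im_inner_apply_self_eq_zero (hA : A.IsFormalAdjoint A) (φ : A.domain) :
    (inner ℂ (φ : H) (A φ)).im = 0 := by
  rw [← Complex.conj_eq_iff_im, inner_conj_symm, hA]

theorem mul_norm_le_norm_smul_sub_apply (hA : A.IsFormalAdjoint A) (z : ℂ) (φ : A.domain) :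
    z.im * ‖(φ : H)‖ ≤ ‖z • (φ : H) - A φ‖ := by
  have him : (inner ℂ (φ : H) (z • (φ : H) - A φ)).im = z.im * ‖(φ : H)‖ ^ 2 := by
    rw [inner_sub_right, inner_smul_right, inner_self_eq_norm_sq_to_K, Complex.sub_im,
      im_inner_apply_self_eq_zero hA, sub_zero]
    simp only [Complex.coe_algebraMap, ← Complex.ofReal_pow, Complex.im_mul_ofReal]
  have hle : z.im * ‖(φ : H)‖ ^ 2 ≤ ‖(φ : H)‖ * ‖z • (φ : H) - A φ‖ :=
    him ▸ (Complex.im_le_norm _).trans (norm_inner_le_norm _ _)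
  rcases (norm_nonneg (φ : H)).eq_or_lt with h0 | hpos
  · rw [← h0, mul_zero]
    exact norm_nonneg _
  · nlinarith

theorem inner_apply_sub_smul (hA : A.IsFormalAdjoint A) (c : ℝ) (ω φ : A.domain) :
    inner ℂ (A ω - (c : ℂ) • (ω : H)) (φ : H) = inner ℂ (ω : H) (A φ - (c : ℂ) • (φ : H)) := by
  rw [inner_sub_left, inner_sub_right, inner_smul_left, inner_smul_right, Complex.conj_ofReal, hA]

theorem smul_sub_apply_smul_resolvent_sub {z : ℂ} {ω ψ : A.domain}
    (hψ : z • (ψ : H) - A ψ = ω) (c : ℂ) :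
    z • (((z - c) • ψ - ω : A.domain) : H) - A ((z - c) • ψ - ω) = A ω - c • (ω : H) := by
  calc z • (((z - c) • ψ - ω : A.domain) : H) - A ((z - c) • ψ - ω)
      = (z - c) • (z • (ψ : H) - A ψ) - z • (ω : H) + A ω := by
        simp only [LinearPMap.map_sub, LinearPMap.map_smul, Submodule.coe_sub, Submodule.coe_smul]
        module
    _ = A ω - c • (ω : H) := by
        rw [hψ]
        module

theorem HasDistribution.sq_mul_one_add_im_cauchyTransform_le (hA : A.IsFormalAdjoint A)
    {ω : A.domain} (hω : ‖(ω : H)‖ = 1) {ρ : ProbabilityMeasure ℝ} (hρ : HasDistribution A ω ρ)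
    (c : ℝ) {y : ℝ} (hy : 0 < y) :
    y ^ 2 * (1 + y * (cauchyTransform ρ ⟨c, y⟩).im) ≤ ‖A ω - (c : ℂ) • (ω : H)‖ ^ 2 := by
  obtain ⟨ψ, hψ, hG⟩ := hρ ⟨c, y⟩ hy
  set z : ℂ := ⟨c, y⟩ with hz
  have hzy : z - c = y * Complex.I := by rw [hz, Complex.mk_eq_add_mul_I, add_sub_cancel_left]
  let v : H := A ω - (c : ℂ) • (ω : H)
  let φ : A.domain := (y * Complex.I) • ψ - ω
  have hφ : z • (φ : H) - A φ = v := by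
    simpa only [φ, ← hzy] using smul_sub_apply_smul_resolvent_sub hψ (c : ℂ)
  have hbound : y * ‖(φ : H)‖ ≤ ‖v‖ := hφ ▸ mul_norm_le_norm_smul_sub_apply hA z φ
  have hinner : y * Complex.I * inner ℂ (ω : H) (φ : H)
      = inner ℂ (ω : H) v + inner ℂ v (φ : H) := by
    rw [inner_apply_sub_smul hA, ← inner_add_right, ← inner_smul_right, ← hφ, ← hzy]
    congr 1
    module
  have hreal : (inner ℂ (ω : H) v).im = 0 := by
    rw [← Complex.conj_eq_iff_im, inner_conj_symm, inner_apply_sub_smul hA]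
  have hvφ : y * (1 + y * (cauchyTransform ρ z).im) = -(inner ℂ v (φ : H)).im := by
    have hωφ : inner ℂ (ω : H) (φ : H) = y * Complex.I * cauchyTransform ρ z - 1 := by
      rw [← hG, ← inner_smul_right, Submodule.coe_sub, inner_sub_right,
        inner_self_eq_one_of_norm_eq_one hω, Submodule.coe_smul]
    have him : (y * Complex.I * (y * Complex.I * cauchyTransform ρ z - 1)).im
        = -(y * (1 + y * (cauchyTransform ρ z).im)) := by
      simp only [mul_sub, mul_one, mul_assoc, Complex.sub_im, Complex.re_ofReal_mul,
        Complex.im_ofReal_mul, Complex.I_mul_im, Complex.I_mul_re, Complex.I_im]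
      ring
    rw [← neg_eq_iff_eq_neg, ← him, ← hωφ, hinner, Complex.add_im, hreal, zero_add]
  calc y ^ 2 * (1 + y * (cauchyTransform ρ z).im)
      = y * -(inner ℂ v (φ : H)).im := by rw [← hvφ]; ring
    _ ≤ y * (‖v‖ * ‖(φ : H)‖) := by
        gcongr
        exact (neg_le_abs _).trans ((Complex.abs_im_le_norm _).trans (norm_inner_le_norm _ _))
    _ ≤ ‖v‖ ^ 2 := by nlinarith [norm_nonneg v]

theorem HasDistribution.lintegral_sub_sq_le (hA : A.IsFormalAdjoint A)
    {ω : A.domain} (hω : ‖(ω : H)‖ = 1) {ρ : ProbabilityMeasure ℝ} (hρ : HasDistribution A ω ρ)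
    (c : ℝ) :
    ∫⁻ t, ENNReal.ofReal ((t - c) ^ 2) ∂(ρ : Measure ℝ)
      ≤ ENNReal.ofReal (‖A ω - (c : ℂ) • (ω : H)‖ ^ 2) :=
  lintegral_sub_sq_le_of_cauchyTransform fun _ hy =>
    hρ.sq_mul_one_add_im_cauchyTransform_le hA hω c hy

theorem HasDistribution.memLp_two (hA : A.IsFormalAdjoint A)
    {ω : A.domain} (hω : ‖(ω : H)‖ = 1) {ρ : ProbabilityMeasure ℝ} (hρ : HasDistribution A ω ρ) :
    MemLp (fun t : ℝ => t) 2 (ρ : Measure ℝ) := by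
  have h := hρ.lintegral_sub_sq_le hA hω 0
  simp only [sub_zero] at h
  rw [memLp_two_iff_integrable_sq (by fun_prop)]
  refine ⟨by fun_prop, ?_⟩
  rw [hasFiniteIntegral_iff_ofReal (ae_of_all _ fun t => sq_nonneg _)]
  exact h.trans_lt ENNReal.ofReal_lt_top

theorem HasDistribution.integral_sub_sq_le (hA : A.IsFormalAdjoint A)
    {ω : A.domain} (hω : ‖(ω : H)‖ = 1) {ρ : ProbabilityMeasure ℝ} (hρ : HasDistribution A ω ρ)
    (c : ℝ) :
    ∫ t, (t - c) ^ 2 ∂(ρ : Measure ℝ) ≤ ‖A ω - (c : ℂ) • (ω : H)‖ ^ 2 := by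
  rw [integral_eq_lintegral_of_nonneg_ae (ae_of_all _ fun t => sq_nonneg _)
    (by fun_prop : Measurable _).aestronglyMeasurable]
  exact ENNReal.toReal_le_of_le_ofReal (sq_nonneg _) (hρ.lintegral_sub_sq_le hA hω c)

end FormallySelfAdjoint

section FiniteDimensional

theorem exists_cauchyTransform_eq_sum {ι : Type*} [Fintype ι] {w : ι → ℝ} (hw : ∀ i, 0 ≤ w i)
    (hsum : ∑ i, w i = 1) (x : ι → ℝ) :
    ∃ ρ : ProbabilityMeasure ℝ, ∀ z : ℂ,
      cauchyTransform ρ z = ∑ i, (w i : ℂ) * (z - (x i : ℂ))⁻¹ := by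
  let m : Measure ℝ := ∑ i, ENNReal.ofReal (w i) • Measure.dirac (x i)
  have hm : IsProbabilityMeasure m := by
    constructor
    simp only [m, Measure.finsetSum_apply, Measure.smul_apply, measure_univ, smul_eq_mul, mul_one]
    rw [← ENNReal.ofReal_sum_of_nonneg fun i _ => hw i, hsum, ENNReal.ofReal_one]
  refine ⟨⟨m, hm⟩, fun z => ?_⟩
  have hmeas : StronglyMeasurable fun t : ℝ => (z - (t : ℂ))⁻¹ :=
    (by fun_prop : Measurable _).stronglyMeasurable
  have hint : ∀ i ∈ Finset.univ, Integrable (fun t : ℝ => (z - (t : ℂ))⁻¹)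
      (ENNReal.ofReal (w i) • Measure.dirac (x i)) := fun i _ =>
    (integrable_dirac' hmeas enorm_lt_top).smul_measure ENNReal.ofReal_ne_top
  refine (integral_finsetSum_measure hint).trans ?_
  refine Finset.sum_congr rfl fun i _ => ?_
  rw [integral_smul_measure, integral_dirac' _ _ hmeas, ENNReal.toReal_ofReal (hw i),
    Complex.real_smul]

theorem exists_hasDistribution_of_finiteDimensional {H : Type*} [NormedAddCommGroup H]
    [InnerProductSpace ℂ H] [FiniteDimensional ℂ H] {A : H →ₗ.[ℂ] H} (hA : A.IsFormalAdjoint A)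
    (htop : A.domain = ⊤) {ω : H} (hω : ‖ω‖ = 1) : ∃ ρ, HasDistribution A ω ρ := by
  have hmem : ∀ ψ, ψ ∈ A.domain := fun ψ => htop ▸ Submodule.mem_top
  let T : H →ₗ[ℂ] H := A.toFun ∘ₗ (LinearMap.id.codRestrict A.domain hmem)
  have hT : T.IsSymmetric := fun ψ φ => hA ⟨ψ, hmem ψ⟩ ⟨φ, hmem φ⟩
  let e := hT.eigenvectorBasis rfl
  let l := hT.eigenvalues rfl
  have hTe : ∀ i, T (e i) = (l i : ℂ) • e i := hT.apply_eigenvectorBasis rfl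
  obtain ⟨ρ, hρ⟩ := exists_cauchyTransform_eq_sum (fun i => sq_nonneg ‖inner ℂ (e i) ω‖)
    (by rw [e.sum_sq_norm_inner_right, hω, one_pow]) l
  refine ⟨ρ, fun z hz => ?_⟩
  let ψ : H := ∑ i, (inner ℂ (e i) ω * (z - l i)⁻¹) • e i
  refine ⟨⟨ψ, hmem ψ⟩, ?_, ?_⟩
  · calc z • ψ - T ψ = ∑ i, inner ℂ (e i) ω • e i := by
          simp only [ψ, map_sum, map_smul, hTe, Finset.smul_sum, ← Finset.sum_sub_distrib]
          refine Finset.sum_congr rfl fun i _ => ?_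
          rw [smul_comm z, ← smul_sub, ← sub_smul, smul_smul,
            inv_mul_cancel_right₀ (sub_ofReal_ne_zero hz _)]
      _ = ω := e.sum_repr' ω
  · rw [hρ, inner_sum]
    refine Finset.sum_congr rfl fun i _ => ?_
    rw [inner_smul_right, ← inner_conj_symm ω, mul_right_comm, Complex.mul_conj']
    push_cast
    rfl

end FiniteDimensional

section FinitelySupported

theorem memLp_of_ae_mem_finite {α E : Type*} [MeasurableSpace α] [MeasurableSingletonClass α]
    [NormedAddCommGroup E] {m : Measure α} [IsFiniteMeasure m] {s : Set α} (hs : s.Finite)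
    (hm : ∀ᵐ x ∂m, x ∈ s) (f : α → E) (p : ENNReal) : MemLp f p m := by
  have hf : f =ᵐ[m] ∑ x ∈ hs.toFinset, ({x} : Set α).indicator fun _ => f x := by
    filter_upwards [hm] with y hy
    rw [Finset.sum_apply, Finset.sum_eq_single_of_mem y (hs.mem_toFinset.2 hy)
      fun x _ hxy => Set.indicator_of_notMem (fun h => hxy (Set.mem_singleton_iff.1 h).symm) _]
    exact (Set.indicator_of_mem (Set.mem_singleton y) _).symm
  refine (memLp_congr_ae hf).2 (memLp_finsetSum' _ fun x _ => ?_)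
  exact memLp_indicator_const p (measurableSet_singleton x) (f x) (Or.inr (measure_ne_top m _))

theorem finiteDimensional_Lp_of_ae_mem_finite {𝕜 α : Type*} [NormedField 𝕜] [MeasurableSpace α]
    [MeasurableSingletonClass α] {m : Measure α} [IsFiniteMeasure m] {s : Set α} (hs : s.Finite)
    (hm : ∀ᵐ x ∂m, x ∈ s) (p : ENNReal) : FiniteDimensional 𝕜 (Lp 𝕜 p m) := by
  have := hs.to_subtype
  let T : (s → 𝕜) →ₗ[𝕜] Lp 𝕜 p m :=
    { toFun := fun g => (memLp_of_ae_mem_finite hs hm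
        (Function.ExtendByZero.linearMap 𝕜 ((↑) : s → α) g) p).toLp _
      map_add' := fun g h => by
        rw [← MemLp.toLp_add]
        exact MemLp.toLp_congr _ _ (by rw [map_add])
      map_smul' := fun c g => by
        rw [RingHom.id_apply, ← MemLp.toLp_const_smul]
        exact MemLp.toLp_congr _ _ (by rw [map_smul]) }
  refine Module.Finite.of_surjective T fun f => ⟨fun x => f x, Lp.ext ?_⟩
  filter_upwards [(memLp_of_ae_mem_finite hs hm (Function.ExtendByZero.linearMap 𝕜
    ((↑) : s → α) fun x => f x) p).coeFn_toLp, hm] with x hx hxs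
  exact hx.trans (Subtype.val_injective.extend_apply (fun x : s => f x) 0 ⟨x, hxs⟩)

theorem exists_tendsto_ae_mem_finite {E : Type*} [MetricSpace E] [SecondCountableTopology E]
    [MeasurableSpace E] [BorelSpace E] (μ : ProbabilityMeasure E) :
    ∃ μs : ℕ → ProbabilityMeasure E, Tendsto μs atTop (𝓝 μ) ∧
      ∀ n, ∃ s : Set E, s.Finite ∧ ∀ᵐ x ∂(μs n : Measure E), x ∈ s := by
  obtain ⟨x₀⟩ := μ.nonempty
  let X : ℕ → SimpleFunc E E :=
    SimpleFunc.approxOn id measurable_id Set.univ x₀ (Set.mem_univ x₀)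
  have hX : ∀ n, AEMeasurable (X n) (μ : Measure E) := fun n => (X n).measurable.aemeasurable
  refine ⟨fun n => μ.map (hX n), ?_, fun n => ⟨_, (X n).finite_range, ?_⟩⟩
  · have hae : ∀ᵐ t ∂(μ : Measure E), Tendsto (fun n => X n t) atTop (𝓝 (id t)) :=
      ae_of_all _ fun t => SimpleFunc.tendsto_approxOn measurable_id (Set.mem_univ x₀) (by simp)
    have hlim := (tendstoInDistribution_of_ae_tendsto hX aemeasurable_id hae).tendsto
    simp only [Measure.map_id] at hlim
    exact hlim
  · rw [ProbabilityMeasure.toMeasure_map]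
    exact ae_map_mem_range _ (X n).finite_range.measurableSet _

end FinitelySupported

section SecondMoments

variable {Ω Ω' : Type*} [MeasurableSpace Ω] [MeasurableSpace Ω'] {P : Measure Ω} {Q : Measure Ω'}
  [IsProbabilityMeasure P] [IsProbabilityMeasure Q] {X : Ω → ℝ} {Y : Ω' → ℝ}

theorem integral_sub_sq_eq_variance_add (hX : MemLp X 2 P) (c : ℝ) :
    ∫ ω, (X ω - c) ^ 2 ∂P = variance X P + (∫ ω, X ω ∂P - c) ^ 2 := by
  have hvar := variance_eq_sub (hX.sub (memLp_const c))
  have hmean : ∫ ω, (X ω - c) ∂P = ∫ ω, X ω ∂P - c := by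
    rw [integral_sub (hX.integrable one_le_two) (integrable_const c), integral_const,
      probReal_univ, one_smul]
  have hconst : variance (X - fun _ => c) P = variance X P :=
    variance_sub_const hX.aestronglyMeasurable c
  simp only [hconst, Pi.pow_apply, Pi.sub_apply, hmean] at hvar
  linarith

theorem integral_eq_and_variance_le_of_forall_integral_sub_sq_le (hX : MemLp X 2 P)
    (hY : MemLp Y 2 Q) (h : ∀ c : ℝ, ∫ ω, (X ω - c) ^ 2 ∂P ≤ ∫ ω, (Y ω - c) ^ 2 ∂Q) :
    ∫ ω, X ω ∂P = ∫ ω, Y ω ∂Q ∧ variance X P ≤ variance Y Q := by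
  simp only [integral_sub_sq_eq_variance_add hX, integral_sub_sq_eq_variance_add hY] at h
  set a := ∫ ω, X ω ∂P
  set b := ∫ ω, Y ω ∂Q
  set k := variance Y Q - variance X P
  have hlin : ∀ c : ℝ, (a - b) * (a + b - 2 * c) ≤ k := fun c => by linarith [h c]
  have hmean : a = b := by
    by_contra hne
    have hd : a - b ≠ 0 := sub_ne_zero.2 hne
    have hlarge : (a - b) * (a + b - 2 * ((a + b) / 2 - (k + 1) / (2 * (a - b)))) = k + 1 := by
      field_simp
      ring
    linarith [hlin ((a + b) / 2 - (k + 1) / (2 * (a - b)))]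
  exact ⟨hmean, by simpa [hmean] using h b⟩

theorem norm_sq_eq_integral_sq {α : Type*} [MeasurableSpace α] {m : Measure α} {f : Lp ℂ 2 m}
    {g : α → ℝ} (h : f =ᵐ[m] fun p => (g p : ℂ)) : ‖f‖ ^ 2 = ∫ p, g p ^ 2 ∂m := by
  have hinner : inner ℂ f f = ((∫ p, g p ^ 2 ∂m : ℝ) : ℂ) := by
    rw [L2.inner_def, ← integral_complex_ofReal]
    refine integral_congr_ae ?_
    filter_upwards [h] with p hp
    rw [hp, RCLike.inner_apply, Complex.conj_ofReal, ← Complex.ofReal_mul, ← sq]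
  rw [norm_sq_eq_re_inner (𝕜 := ℂ), hinner]
  exact RCLike.ofReal_re_ax _

end SecondMoments

section MonotoneConvolution

variable {μ ν : ProbabilityMeasure ℝ}

theorem inner_monotoneLeft (ψ : (monotoneLeft μ ν).domain) (φ : MonotoneSpace μ ν) :
    inner ℂ (monotoneLeft μ ν ψ) φ
      = ∫ x, (x : ℂ) * (starRingEnd ℂ (∫ y, (ψ : MonotoneSpace μ ν) (x, y) ∂(ν : Measure ℝ))
          * ∫ y, φ (x, y) ∂(ν : Measure ℝ)) ∂(μ : Measure ℝ) := by
  rw [L2.inner_def, integral_prod _ (L2.integrable_inner _ _)]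
  refine integral_congr_ae ?_
  filter_upwards [Measure.ae_ae_of_ae_prod (MemLp.coeFn_toLp ψ.2)] with x hx
  rw [← integral_const_mul, ← integral_const_mul]
  refine integral_congr_ae ?_
  filter_upwards [hx] with y hy
  have happ : (monotoneLeft μ ν ψ) (x, y)
    = x * ∫ y, (ψ : MonotoneSpace μ ν) (x, y) ∂(ν : Measure ℝ) := hy
  rw [happ, RCLike.inner_apply, map_mul, Complex.conj_ofReal]
  ring

theorem isFormalAdjoint_monotoneLeft : (monotoneLeft μ ν).IsFormalAdjoint (monotoneLeft μ ν) :=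
  fun ψ φ => by
  rw [← inner_conj_symm (ψ : MonotoneSpace μ ν), inner_monotoneLeft, inner_monotoneLeft,
    ← integral_conj]
  refine integral_congr_ae (ae_of_all _ fun x => ?_)
  simp only [map_mul, Complex.conj_conj, Complex.conj_ofReal]
  ring

theorem isFormalAdjoint_monotoneRight :
    (monotoneRight μ ν).IsFormalAdjoint (monotoneRight μ ν) := fun ψ φ => by
  rw [L2.inner_def, L2.inner_def]
  refine integral_congr_ae ?_
  filter_upwards [MemLp.coeFn_toLp ψ.2, MemLp.coeFn_toLp φ.2] with p hψ hφ
  have hψ' : (monotoneRight μ ν ψ) p = p.2 * (ψ : MonotoneSpace μ ν) p := hψ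
  have hφ' : (monotoneRight μ ν φ) p = p.2 * (φ : MonotoneSpace μ ν) p := hφ
  rw [hψ', hφ', RCLike.inner_apply, RCLike.inner_apply, map_mul, Complex.conj_ofReal]
  ring

theorem isFormalAdjoint_monotoneLeft_add_monotoneRight :
    (monotoneLeft μ ν + monotoneRight μ ν).IsFormalAdjoint (monotoneLeft μ ν + monotoneRight μ ν) :=
  isFormalAdjoint_add isFormalAdjoint_monotoneLeft isFormalAdjoint_monotoneRight

theorem norm_vacuum : ‖vacuum μ ν‖ = 1 :=
  (Lp.norm_const' 2 _ (1 : ℂ) two_ne_zero ENNReal.ofNat_ne_top).trans (by simp)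

theorem leftFun_vacuum : leftFun ν (vacuum μ ν)
    =ᵐ[(μ : Measure ℝ).prod (ν : Measure ℝ)] fun p => (p.1 : ℂ) := by
  refine Measure.quasiMeasurePreserving_fst.ae (p := fun x : ℝ =>
    (x : ℂ) * ∫ y, vacuum μ ν (x, y) ∂(ν : Measure ℝ) = x) ?_
  filter_upwards [Measure.ae_ae_of_ae_prod (vacuum_ae μ ν)] with x hx
  rw [integral_congr_ae hx, integral_const, probReal_univ, one_smul, mul_one]

theorem mul_vacuum : (fun p : ℝ × ℝ => (p.2 : ℂ) * vacuum μ ν p)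
    =ᵐ[(μ : Measure ℝ).prod (ν : Measure ℝ)] fun p => (p.2 : ℂ) := by
  filter_upwards [vacuum_ae μ ν] with p hp
  rw [hp, mul_one]

theorem vacuum_mem_domain_add (hμ : MemLp (fun t : ℝ => t) 2 (μ : Measure ℝ))
    (hν : MemLp (fun t : ℝ => t) 2 (ν : Measure ℝ)) :
    vacuum μ ν ∈ (monotoneLeft μ ν + monotoneRight μ ν).domain :=
  ⟨(memLp_congr_ae leftFun_vacuum).2 (hμ.comp_fst _).ofReal,
    (memLp_congr_ae mul_vacuum).2 (hν.comp_snd _).ofReal⟩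

theorem apply_vacuum_sub (h : vacuum μ ν ∈ (monotoneLeft μ ν + monotoneRight μ ν).domain) (c : ℝ) :
    (monotoneLeft μ ν + monotoneRight μ ν) ⟨vacuum μ ν, h⟩ - (c : ℂ) • vacuum μ ν
      =ᵐ[(μ : Measure ℝ).prod (ν : Measure ℝ)] fun p => ((p.1 + p.2 - c : ℝ) : ℂ) := by
  filter_upwards [Lp.coeFn_sub (h.1.toLp _ + h.2.toLp _) ((c : ℂ) • vacuum μ ν),
    Lp.coeFn_add (h.1.toLp _) (h.2.toLp _), Lp.coeFn_smul (c : ℂ) (vacuum μ ν), h.1.coeFn_toLp,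
    h.2.coeFn_toLp, leftFun_vacuum (μ := μ) (ν := ν), mul_vacuum (μ := μ) (ν := ν),
    vacuum_ae μ ν] with p hsub hadd hsmul hX hY hX' hY' hv
  refine hsub.trans ?_
  rw [Pi.sub_apply, hadd, hsmul, Pi.add_apply, hX, hY, hX', hY', Pi.smul_apply, hv]
  simp

theorem IsMonotoneConvolution.memLp_two (hμ : MemLp (fun t : ℝ => t) 2 (μ : Measure ℝ))
    (hν : MemLp (fun t : ℝ => t) 2 (ν : Measure ℝ)) {ρ : ProbabilityMeasure ℝ}
    (hρ : IsMonotoneConvolution μ ν ρ) : MemLp (fun t : ℝ => t) 2 (ρ : Measure ℝ) :=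
  HasDistribution.memLp_two isFormalAdjoint_monotoneLeft_add_monotoneRight
    (ω := ⟨_, vacuum_mem_domain_add hμ hν⟩) norm_vacuum hρ

theorem IsMonotoneConvolution.integral_sub_sq_le (hμ : MemLp (fun t : ℝ => t) 2 (μ : Measure ℝ))
    (hν : MemLp (fun t : ℝ => t) 2 (ν : Measure ℝ)) {ρ : ProbabilityMeasure ℝ}
    (hρ : IsMonotoneConvolution μ ν ρ) (c : ℝ) :
    ∫ t, (t - c) ^ 2 ∂(ρ : Measure ℝ)
      ≤ ∫ p, (p.1 + p.2 - c) ^ 2 ∂((μ : Measure ℝ).prod (ν : Measure ℝ)) := by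
  rw [← norm_sq_eq_integral_sq (apply_vacuum_sub (vacuum_mem_domain_add hμ hν) c)]
  exact HasDistribution.integral_sub_sq_le isFormalAdjoint_monotoneLeft_add_monotoneRight
    (ω := ⟨_, vacuum_mem_domain_add hμ hν⟩) norm_vacuum hρ c

theorem IsMonotoneConvolution.integral_eq
    (hμ : MemLp (fun t : ℝ => t) 2 (μ : Measure ℝ)) (hν : MemLp (fun t : ℝ => t) 2 (ν : Measure ℝ))
    {ρ : ProbabilityMeasure ℝ} (hρ : IsMonotoneConvolution μ ν ρ) :
    ∫ t, t ∂(ρ : Measure ℝ) = ∫ t, t ∂(μ : Measure ℝ) + ∫ t, t ∂(ν : Measure ℝ) := by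
  have hfst := hμ.comp_fst (ν : Measure ℝ)
  have hsnd := hν.comp_snd (μ : Measure ℝ)
  calc ∫ t, t ∂(ρ : Measure ℝ)
      = ∫ p : ℝ × ℝ, (p.1 + p.2) ∂((μ : Measure ℝ).prod (ν : Measure ℝ)) :=
        (integral_eq_and_variance_le_of_forall_integral_sub_sq_le (hρ.memLp_two hμ hν)
          (hfst.add hsnd) (hρ.integral_sub_sq_le hμ hν)).1
    _ = ∫ t, t ∂(μ : Measure ℝ) + ∫ t, t ∂(ν : Measure ℝ) := by
        rw [integral_add (hfst.integrable one_le_two) (hsnd.integrable one_le_two),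
          integral_fun_fst fun t : ℝ => t, integral_fun_snd fun t : ℝ => t]
        simp

theorem IsMonotoneConvolution.variance_le
    (hμ : MemLp (fun t : ℝ => t) 2 (μ : Measure ℝ)) (hν : MemLp (fun t : ℝ => t) 2 (ν : Measure ℝ))
    {ρ : ProbabilityMeasure ℝ} (hρ : IsMonotoneConvolution μ ν ρ) :
    variance (fun t : ℝ => t) (ρ : Measure ℝ)
      ≤ variance (fun t : ℝ => t) (μ : Measure ℝ) + variance (fun t : ℝ => t) (ν : Measure ℝ) := by
  have hfst := hμ.comp_fst (ν : Measure ℝ)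
  have hsnd := hν.comp_snd (μ : Measure ℝ)
  obtain ⟨-, hvar⟩ := integral_eq_and_variance_le_of_forall_integral_sub_sq_le
    (hρ.memLp_two hμ hν) (hfst.add hsnd) (hρ.integral_sub_sq_le hμ hν)
  have hprod := variance_add_prod (μ := (μ : Measure ℝ)) (ν := (ν : Measure ℝ)) hμ hν
  exact hvar.trans_eq hprod

end MonotoneConvolution

section Existence

theorem exists_isMonotoneConvolution_of_ae_mem_finite {μ ν : ProbabilityMeasure ℝ} {s t : Set ℝ}
    (hs : s.Finite) (ht : t.Finite) (hμ : ∀ᵐ x ∂(μ : Measure ℝ), x ∈ s)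
    (hν : ∀ᵐ y ∂(ν : Measure ℝ), y ∈ t) : ∃ ρ, IsMonotoneConvolution μ ν ρ := by
  have hμν : ∀ᵐ p ∂(μ : Measure ℝ).prod (ν : Measure ℝ), p ∈ s ×ˢ t := by
    filter_upwards [Measure.quasiMeasurePreserving_fst.ae hμ,
      Measure.quasiMeasurePreserving_snd.ae hν] with p hp₁ hp₂ using ⟨hp₁, hp₂⟩
  have hfin := hs.prod ht
  have := finiteDimensional_Lp_of_ae_mem_finite (𝕜 := ℂ) hfin hμν 2
  refine exists_hasDistribution_of_finiteDimensional
    isFormalAdjoint_monotoneLeft_add_monotoneRight ?_ norm_vacuum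
  exact Submodule.eq_top_iff'.2 fun _ =>
    ⟨memLp_of_ae_mem_finite hfin hμν _ 2, memLp_of_ae_mem_finite hfin hμν _ 2⟩

theorem isMonotoneConvolution_iff_cauchyTransform (μ ν ρ : ProbabilityMeasure ℝ) :
    IsMonotoneConvolution μ ν ρ ↔ ∀ z : ℂ, 0 < z.im →
      cauchyTransform ρ z = cauchyTransform μ (reciprocalCauchyTransform ν z) := by
  rw [isMonotoneConvolution_iff]
  exact forall₂_congr fun z _ => inv_inj

theorem exists_isMonotoneConvolution (μ ν : ProbabilityMeasure ℝ) :
    ∃ ρ, IsMonotoneConvolution μ ν ρ := by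
  obtain ⟨μs, hμs, hμfin⟩ := exists_tendsto_ae_mem_finite μ
  obtain ⟨νs, hνs, hνfin⟩ := exists_tendsto_ae_mem_finite ν
  have hρs : ∀ n, ∃ ρ, IsMonotoneConvolution (μs n) (νs n) ρ := fun n => by
    obtain ⟨s, hs, hμ⟩ := hμfin n
    obtain ⟨t, ht, hν⟩ := hνfin n
    exact exists_isMonotoneConvolution_of_ae_mem_finite hs ht hμ hν
  choose ρs hρs using hρs
  simp only [isMonotoneConvolution_iff_cauchyTransform] at hρs ⊢
  refine exists_cauchyTransform_eq_of_tendsto (ρs := ρs) (fun z hz => ?_) ?_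
  · have hF : Tendsto (fun n => reciprocalCauchyTransform (νs n) z) atTop
        (𝓝 (reciprocalCauchyTransform ν z)) :=
      (tendsto_cauchyTransform hνs hz).inv₀ (cauchyTransform_ne_zero ν hz)
    refine (tendsto_cauchyTransform_of_tendsto hμs
      (reciprocalCauchyTransform_im_pos ν hz) hF).congr fun n => (hρs n z hz).symm
  · have hlim := (Complex.continuous_im.tendsto _).comp
      (tendsto_mul_cauchyTransform μ (tendsto_reciprocalCauchyTransform_div ν))
    simpa [Function.comp_def] using hlim

theorem isMonotoneConvolution_monotoneConvolution (μ ν : ProbabilityMeasure ℝ) :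
    IsMonotoneConvolution μ ν (monotoneConvolution μ ν) :=
  Classical.epsilon_spec (exists_isMonotoneConvolution μ ν)

end Existence

section Iteration

variable {μ : ℕ → ProbabilityMeasure ℝ}

theorem memLp_two_iteratedMonotoneConvolution
    (hμ : ∀ n, MemLp (fun t : ℝ => t) 2 (μ n : Measure ℝ)) (n : ℕ) :
    MemLp (fun t : ℝ => t) 2 (iteratedMonotoneConvolution μ n : Measure ℝ) := by
  induction n with
  | zero => exact hμ 0
  | succ n ih => exact (isMonotoneConvolution_monotoneConvolution _ _).memLp_two ih (hμ (n + 1))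

theorem integral_iteratedMonotoneConvolution
    (hμ : ∀ n, MemLp (fun t : ℝ => t) 2 (μ n : Measure ℝ)) (n : ℕ) :
    ∫ t, t ∂(iteratedMonotoneConvolution μ n : Measure ℝ)
      = ∑ k ∈ Finset.range (n + 1), ∫ t, t ∂(μ k : Measure ℝ) := by
  induction n with
  | zero => simp [iteratedMonotoneConvolution]
  | succ n ih =>
    rw [Finset.sum_range_succ, ← ih]
    exact (isMonotoneConvolution_monotoneConvolution _ _).integral_eq
      (memLp_two_iteratedMonotoneConvolution hμ n) (hμ (n + 1))

theorem variance_iteratedMonotoneConvolution_le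
    (hμ : ∀ n, MemLp (fun t : ℝ => t) 2 (μ n : Measure ℝ)) (n : ℕ) :
    variance (fun t : ℝ => t) (iteratedMonotoneConvolution μ n : Measure ℝ)
      ≤ ∑ k ∈ Finset.range (n + 1), variance (fun t : ℝ => t) (μ k : Measure ℝ) := by
  induction n with
  | zero => simp [iteratedMonotoneConvolution]
  | succ n ih =>
    rw [Finset.sum_range_succ]
    exact ((isMonotoneConvolution_monotoneConvolution _ _).variance_le
      (memLp_two_iteratedMonotoneConvolution hμ n) (hμ (n + 1))).trans (add_le_add_left ih _)

end Iteration

section Stability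

theorem tendsto_sum_range_div_of_summable_div {v d : ℕ → ℝ} (hd : ∀ k, 0 < d k)
    (hmono : Monotone d) (hlim : Tendsto d atTop atTop) (hsum : Summable fun k => |v k| / d k) :
    Tendsto (fun n => (∑ k ∈ Finset.range (n + 1), v k) / d n) atTop (𝓝 0) := by
  let f : ℕ → ℕ → ℝ := fun n => (Finset.range (n + 1) : Set ℕ).indicator fun k => v k / d n
  have hf : Tendsto (fun n => ∑' k, f n k) atTop (𝓝 (∑' _ : ℕ, 0)) := by
    refine tendsto_tsum_of_dominated_convergence hsum (fun k => ?_)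
      (Eventually.of_forall fun n k => ?_)
    · refine (hlim.const_div_atTop (v k)).congr' ?_
      filter_upwards [eventually_ge_atTop k] with n hn
      exact (Set.indicator_of_mem (Finset.mem_range_succ_iff.2 hn) fun k => v k / d n).symm
    · simp only [f]
      by_cases hk : k ∈ (Finset.range (n + 1) : Set ℕ)
      · rw [Set.indicator_of_mem hk, norm_div, Real.norm_of_nonneg (hd n).le, Real.norm_eq_abs]
        exact div_le_div_of_nonneg_left (abs_nonneg _) (hd k)
          (hmono (Finset.mem_range_succ_iff.1 hk))
      · rw [Set.indicator_of_notMem hk, norm_zero]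
        exact div_nonneg (abs_nonneg _) (hd k).le
  rw [tsum_zero] at hf
  refine hf.congr fun n => ?_
  rw [Finset.sum_div]
  exact (sum_eq_tsum_indicator _ _).symm

theorem dilation_apply_le_abs_sub (μ : ProbabilityMeasure ℝ) {b : ℝ} (hb : 0 < b) (c ε : ℝ) :
    (dilation (1 / b) μ : Measure ℝ) {t : ℝ | ε ≤ |t - 1 / b * c|}
      = (μ : Measure ℝ) {t : ℝ | ε * b ≤ |t - c|} := by
  have hm : MeasurableSet {t : ℝ | ε ≤ |t - 1 / b * c|} :=
    measurableSet_le measurable_const (by fun_prop)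
  rw [dilation, ProbabilityMeasure.toMeasure_map, Measure.map_apply (measurable_const_mul _) hm]
  congr 1
  ext t
  simp only [Set.mem_preimage, Set.mem_ofPred_eq]
  rw [← mul_sub, abs_mul, abs_of_pos (by positivity : 0 < 1 / b), one_div, inv_mul_eq_div,
    le_div_iff₀ hb]

theorem isStableWith_dilation_of_tendsto_variance_div_sq {ρ : ℕ → ProbabilityMeasure ℝ}
    (hρ : ∀ n, MemLp (fun t : ℝ => t) 2 (ρ n : Measure ℝ)) {b : ℕ → ℝ} (hb : ∀ n, 0 < b n)
    (h : Tendsto (fun n => variance (fun t : ℝ => t) (ρ n : Measure ℝ) / b n ^ 2) atTop (𝓝 0)) :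
    IsStableWith (fun n => dilation (1 / b n) (ρ n))
      (fun n => 1 / b n * ∫ t, t ∂(ρ n : Measure ℝ)) := by
  intro ε hε
  have hlim := ENNReal.tendsto_ofReal (h.div_const (ε ^ 2))
  rw [zero_div, ENNReal.ofReal_zero] at hlim
  refine tendsto_of_tendsto_of_tendsto_of_le_of_le tendsto_const_nhds hlim
    (fun _ => zero_le) fun n => ?_
  simp only
  rw [dilation_apply_le_abs_sub _ (hb n), div_div, mul_comm (b n ^ 2), ← mul_pow]
  exact meas_ge_le_variance_div_sq (hρ n) (mul_pos hε (hb n))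

theorem isStableWith_dilation_iteratedMonotoneConvolution {μ : ℕ → ProbabilityMeasure ℝ}
    (hμ : ∀ n, MemLp (fun t : ℝ => t) 2 (μ n : Measure ℝ)) {b : ℕ → ℝ} (hb : ∀ n, 0 < b n)
    (h : Tendsto (fun n => (∑ k ∈ Finset.range (n + 1),
      variance (fun t : ℝ => t) (μ k : Measure ℝ)) / b n ^ 2) atTop (𝓝 0)) :
    IsStableWith (fun n => dilation (1 / b n) (iteratedMonotoneConvolution μ n))
      (fun n => 1 / b n * ∑ k ∈ Finset.range (n + 1), ∫ t, t ∂(μ k : Measure ℝ)) := by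
  simp only [← integral_iteratedMonotoneConvolution hμ]
  refine isStableWith_dilation_of_tendsto_variance_div_sq
    (memLp_two_iteratedMonotoneConvolution hμ) hb (squeeze_zero (fun n => ?_) (fun n => ?_) h)
  · exact div_nonneg (variance_nonneg _ _) (sq_nonneg _)
  · exact div_le_div_of_nonneg_right (variance_iteratedMonotoneConvolution_le hμ n) (sq_nonneg _)

theorem IsStableWith.tendsto_diracProba {ν : ℕ → ProbabilityMeasure ℝ} {m : ℝ}
    (h : IsStableWith ν fun _ => m) : Tendsto ν atTop (𝓝 (diracProba m)) := by
  refine tendsto_of_forall_isOpen_le_liminf' fun G hG => ?_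
  by_cases hm : m ∈ G
  · obtain ⟨ε, hε, hball⟩ := Metric.isOpen_iff.1 hG m hm
    have hlim : Tendsto (fun n => 1 - (ν n : Measure ℝ) {t : ℝ | ε ≤ |t - m|}) atTop
        (𝓝 (1 - 0)) := ENNReal.Tendsto.sub tendsto_const_nhds (h ε hε) (Or.inl ENNReal.one_ne_top)
    refine prob_le_one.trans ?_
    rw [← tsub_zero (1 : ENNReal), ← hlim.liminf_eq]
    refine liminf_le_liminf (Eventually.of_forall fun n => ?_)
    rw [← prob_compl_eq_one_sub (measurableSet_le measurable_const (by fun_prop))]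
    refine measure_mono fun t ht => hball ?_
    rw [Metric.mem_ball, Real.dist_eq]
    exact not_le.1 ht
  · rw [diracProba_toMeasure_apply' m hG.measurableSet, Set.indicator_of_notMem hm]
    exact zero_le

theorem tendsto_dilation_iteratedMonotoneConvolution_const {ν : ProbabilityMeasure ℝ}
    (hν : MemLp (fun t : ℝ => t) 2 (ν : Measure ℝ)) :
    Tendsto (fun n : ℕ => dilation (1 / ((n : ℝ) + 1)) (iteratedMonotoneConvolution (fun _ => ν) n))
      atTop (𝓝 (diracProba (∫ t, t ∂(ν : Measure ℝ)))) := by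
  have hvar : Tendsto (fun n : ℕ => (∑ _k ∈ Finset.range (n + 1),
      variance (fun t : ℝ => t) (ν : Measure ℝ)) / ((n : ℝ) + 1) ^ 2) atTop (𝓝 0) := by
    have hlim := tendsto_one_div_add_atTop_nhds_zero_nat.const_mul
      (variance (fun t : ℝ => t) (ν : Measure ℝ))
    rw [mul_zero] at hlim
    refine hlim.congr fun n => ?_
    simp only [Finset.sum_const, Finset.card_range, nsmul_eq_mul]
    push_cast
    field_simp
  refine IsStableWith.tendsto_diracProba ?_
  convert isStableWith_dilation_iteratedMonotoneConvolution (fun _ => hν)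
    (fun n => Nat.cast_add_one_pos n) hvar using 2 with n
  simp only [Finset.sum_const, Finset.card_range, nsmul_eq_mul]
  push_cast
  field_simp

end Stability

theorem theorem1p1 (μ : ℕ → ProbabilityMeasure ℝ)
    (hμ : ∀ n, MemLp (fun t : ℝ => t) 2 (μ n : Measure ℝ)) :
    (∀ b : ℕ → ℝ, 0 < b 0 → StrictMono b → Tendsto b atTop atTop →
      Summable (fun k => variance (fun t : ℝ => t) (μ k : Measure ℝ) / b k ^ 2) →
      IsStableSequence (fun n => dilation (1 / b n) (iteratedMonotoneConvolution μ n)) ∧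
      IsStableWith (fun n => dilation (1 / b n) (iteratedMonotoneConvolution μ n))
        (fun n => 1 / b n * ∑ k ∈ Finset.range (n + 1), ∫ t, t ∂(μ k : Measure ℝ))) ∧
    (∀ ν : ProbabilityMeasure ℝ, (∀ n, μ n = ν) →
      Tendsto (fun n : ℕ => dilation (1 / ((n : ℝ) + 1)) (iteratedMonotoneConvolution μ n)) atTop
        (𝓝 (diracProba (∫ t, t ∂(ν : Measure ℝ))))) := by
  refine ⟨fun b hb0 hmono hlim hsum => ?_, fun ν hν => ?_⟩
  · have hb : ∀ n, 0 < b n := fun n => hb0.trans_le (hmono.monotone n.zero_le)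
    have hstable := isStableWith_dilation_iteratedMonotoneConvolution hμ hb
      (tendsto_sum_range_div_of_summable_div (fun k => pow_pos (hb k) 2)
        (fun _ _ hij => pow_le_pow_left₀ (hb _).le (hmono.monotone hij) 2)
        ((tendsto_pow_atTop two_ne_zero).comp hlim)
        (by simpa only [abs_of_nonneg (variance_nonneg _ _)] using hsum))
    exact ⟨⟨_, hstable⟩, hstable⟩
  · obtain rfl : μ = fun _ => ν := funext hν
    exact tendsto_dilation_iteratedMonotoneConvolution_const (hμ 0)
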